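/- Let $d\ge 1$ be an integer, $Q_d:=[0,1]^d$, and fix $a\ge 0$. For $n\ge 1$, for a bounded Borel measurable function $f:Q_d\to\mathbf{R}$ and for $x\in Q_d$, put $$C_n(f)(x):=\sum_{h\in\{0,\dots,n\}^d}\ \prod_{i=1}^d\binom{n}{h_i}x_i^{h_i}(1-x_i)^{n-h_i}\int_{Q_d} f\left(\frac{h_1+au_1}{n+a},\dots,\frac{h_d+au_d}{n+a}\right)du .$$ For $1\le p<+\infty$ and $\delta>0$, the averaged modulus of smoothness of first order of $f$ is $\tau(f;\delta)_p:=\|\omega(f,\cdot\,;\delta)\|_p$, where, for $x\in Q_d$, $$\omega(f,x;\delta):=\sup\{|f(t+h)-f(t)|\ :\ t,\,t+h\in Q_d,\ \|t-x\|_2\le\delta/2,\ \|t+h-x\|_2\le\delta/2\},$$ $\|\cdot\|_2$ is the Euclidean norm and $\|\cdot\|_p$ is the norm of $L^p(Q_d)$ with respect to Lebesgue measure. Then for every $1\le p<+\infty$ there is a constant $C>0$, depending only on $d$, $a$ and $p$, and in particular neither on $f$ nor on $n$, such that for every $n\ge 1$ and every bounded Borel measurable function $f:Q_d\to\mathbf{R}$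 $$\|C_n(f)-f\|_p\le C\,\tau\left(f;\sqrt[2d]{\frac{3n+a^2}{12(n+a)^2}}\right)_p .$$ -/

import Mathlib

open MeasureTheory
open scoped ENNReal

namespace HypercubeKantorovich

/-- The unit hypercube `[0,1]^d` in Euclidean space. -/
def cube (d : ℕ) : Set (EuclideanSpace ℝ (Fin d)) :=
  {x | ∀ i, x i ∈ Set.Icc (0 : ℝ) 1}

/-- The Bernstein polynomial of multi-index `h ∈ {0, …, n}^d`:
`∏ i, (n choose h i) * x i ^ h i * (1 - x i) ^ (n - h i)`. -/
noncomputable def bernsteinWeight {d : ℕ} (n : ℕ) (h : Fin d → Fin (n + 1))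
    (x : EuclideanSpace ℝ (Fin d)) : ℝ :=
  ∏ i, (n.choose (h i : ℕ) : ℝ) * x i ^ (h i : ℕ) * (1 - x i) ^ (n - (h i : ℕ))

/-- The node `(h + a u) / (n + a)`, coordinate by coordinate. -/
noncomputable def node {d : ℕ} (n : ℕ) (a : ℝ) (h : Fin d → Fin (n + 1))
    (u : EuclideanSpace ℝ (Fin d)) : EuclideanSpace ℝ (Fin d) :=
  WithLp.toLp 2 fun i => (((h i : ℕ) : ℝ) + a * u i) / ((n : ℝ) + a)

/-- The operator `C_n` on the hypercube, with parameter `a` and Lebesgue measure: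
`C_n(f)(x) = ∑_h P_{n,h}(x) ∫_{[0,1]^d} f((h + a u)/(n + a)) du`.
For `x` in the cube it uses the values of `f` on the cube only. -/
noncomputable def kantorovich {d : ℕ} (n : ℕ) (a : ℝ)
    (f : EuclideanSpace ℝ (Fin d) → ℝ) (x : EuclideanSpace ℝ (Fin d)) : ℝ :=
  ∑ h : Fin d → Fin (n + 1),
    bernsteinWeight n h x * ∫ u in cube d, f (node n a h u)

/-- The local modulus `ω(f, x; δ)`: the supremum of `|f (t + h) - f t|` over `t, t + h ∈ K` with
`‖t - x‖ ≤ δ/2` and `‖t + h - x‖ ≤ δ/2`, taken in `[0, ∞]`. -/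
noncomputable def localModulus {d : ℕ} (K : Set (EuclideanSpace ℝ (Fin d)))
    (f : EuclideanSpace ℝ (Fin d) → ℝ) (x : EuclideanSpace ℝ (Fin d)) (δ : ℝ) : ℝ≥0∞ :=
  ⨆ (t : EuclideanSpace ℝ (Fin d)) (h : EuclideanSpace ℝ (Fin d))
    (_ : t ∈ K ∧ t + h ∈ K ∧ ‖t - x‖ ≤ δ / 2 ∧ ‖t + h - x‖ ≤ δ / 2),
    ENNReal.ofReal |f (t + h) - f t|

/-- The averaged modulus of smoothness `τ(f, δ)_p`: the `L^p(K)` norm of `x ↦ ω(f, x; δ)`. -/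
noncomputable def averagedModulus {d : ℕ} (K : Set (EuclideanSpace ℝ (Fin d)))
    (f : EuclideanSpace ℝ (Fin d) → ℝ) (δ : ℝ) (p : ℝ≥0∞) : ℝ≥0∞ :=
  eLpNorm (fun x => localModulus K f x δ) p (volume.restrict K)

end HypercubeKantorovich

/-!
Up to constants depending on `d` and `a`, the step `δ` of the modulus is at least `1 / √n`, which is
the scale of the deviation of the nodes from `x` under the Bernstein weights. Cut the cube into
`(N + 1) ^ d` equal cells of side comparable to, but smaller than, `1 / √n`, and let `G k` be the
oscillation of `f` on the cell of index `k` together with its neighbours (`oscillation`). The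
neighbourhood of the cell of `x` lies in the ball of radius `δ / 2` about `x`, so
`G (cellIndex N x) ≤ ω(f, x; δ)` (`oscillation_cellIndex_le_localModulus`). The function
`x ↦ G (cellIndex N x)` is constant on cells, so nothing need be known about the measurability of
the local modulus itself.

If the cells of `x` and `y` are at sup-distance `r`, a chain of touching cells bounds
`|f x - f y|` by the sum of the `G m` over the cells `m` at distance at most `r` from that of `x`
(`edist_le_sum_oscillation`). Inserting geometric weights, this is at most
`exp (η r) * ∑ m, q ^ ‖m - cellIndex N x‖₁ * G m` with `q = exp (-η / d)`
(`edist_le_smoothedOscillation_mul`). For `y` a node and `η` small, `exp (η r)` has a bounded mean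
under the Bernstein weights, because the binomial distribution is subgaussian
(`sum_binomialWeight_mul_exp_abs_le`). Hence the error at `x` is at most a constant times
`∑ m, q ^ ‖m - cellIndex N x‖₁ * G m` (`enorm_kantorovich_sub_le`).

This is a discrete convolution of `G` with a summable kernel, so its `ℓ^p` norm is at most a
constant times that of `G` (`sum_rpow_sum_mul_le`). As all cells have the same volume
(`setLIntegral_cellIndex`), `ℓ^p` norms over the indices are `L^p` norms over the cube, up to a
factor that cancels.
-/

namespace HypercubeKantorovich

/-! ### Exponential moments of the Bernstein weights -/

/-- The probability `(n choose k) t ^ k (1 - t) ^ (n - k)` of `k` successes in `n` trials: one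
factor of `bernsteinWeight`. -/
noncomputable def binomialWeight (n k : ℕ) (t : ℝ) : ℝ :=
  (n.choose k : ℝ) * t ^ k * (1 - t) ^ (n - k)

lemma binomialWeight_nonneg (n k : ℕ) {t : ℝ} (ht : t ∈ Set.Icc (0 : ℝ) 1) :
    0 ≤ binomialWeight n k t := by
  have h1 := ht.1
  have h2 : 0 ≤ 1 - t := by linarith [ht.2]
  unfold binomialWeight
  positivity

lemma sum_binomialWeight (n : ℕ) (t : ℝ) :
    ∑ k : Fin (n + 1), binomialWeight n k t = 1 := by
  rw [Fin.sum_univ_eq_sum_range (fun k => binomialWeight n k t) (n + 1)]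
  have h := add_pow t (1 - t) n
  rw [add_sub_cancel, one_pow] at h
  rw [h]
  exact Finset.sum_congr rfl fun k _ => by unfold binomialWeight; ring

/-- The centred moment generating function of the binomial distribution, in product form. -/
lemma sum_binomialWeight_mul_exp (n : ℕ) (t s : ℝ) :
    ∑ k : Fin (n + 1), binomialWeight n k t * Real.exp (s * ((k : ℕ) - n * t)) =
      (t * Real.exp (s * (1 - t)) + (1 - t) * Real.exp (-(s * t))) ^ n := by
  rw [Fin.sum_univ_eq_sum_range
    (fun k : ℕ => binomialWeight n k t * Real.exp (s * ((k : ℝ) - n * t))) (n + 1), add_pow]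
  refine Finset.sum_congr rfl fun k hk => ?_
  have hkn : k ≤ n := Nat.lt_succ_iff.mp (Finset.mem_range.mp hk)
  have : Real.exp (s * ((k : ℝ) - n * t)) =
      Real.exp (s * (1 - t)) ^ k * Real.exp (-(s * t)) ^ (n - k) := by
    rw [← Real.exp_nat_mul, ← Real.exp_nat_mul, ← Real.exp_add, Nat.cast_sub hkn]
    congr 1
    ring
  rw [this, mul_pow, mul_pow, binomialWeight]
  ring

lemma exp_le_add_exp_sq {s : ℝ} (hs : |s| ≤ 1) : Real.exp s ≤ s + Real.exp (s ^ 2) := by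
  have h1 := (abs_le.mp (Real.abs_exp_sub_one_sub_id_le hs)).2
  have h2 := Real.add_one_le_exp (s ^ 2)
  linarith

/-- A Bernoulli variable of mean `t` is subgaussian; the linear terms of `exp_le_add_exp_sq`
cancel. -/
lemma bernoulli_mgf_le {t s : ℝ} (ht : t ∈ Set.Icc (0 : ℝ) 1) (hs : |s| ≤ 1) :
    t * Real.exp (s * (1 - t)) + (1 - t) * Real.exp (-(s * t)) ≤ Real.exp (s ^ 2) := by
  obtain ⟨h0, h1⟩ := ht
  have key : ∀ u : ℝ, |u| ≤ 1 → Real.exp (s * u) ≤ s * u + Real.exp (s ^ 2) := fun u hu => by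
    have h := exp_le_add_exp_sq (s := s * u) (by
      rw [abs_mul]; exact mul_le_one₀ hs (abs_nonneg _) hu)
    have : Real.exp ((s * u) ^ 2) ≤ Real.exp (s ^ 2) := Real.exp_le_exp.mpr (by
      rw [mul_pow]
      exact mul_le_of_le_one_right (sq_nonneg s) ((sq_le_one_iff_abs_le_one u).mpr hu))
    linarith
  have k1 := mul_le_mul_of_nonneg_left
    (key (1 - t) (abs_le.mpr ⟨by linarith, by linarith⟩)) h0
  have k2 := mul_le_mul_of_nonneg_left
    (key (-t) (abs_le.mpr ⟨by linarith, by linarith⟩)) (by linarith : 0 ≤ 1 - t)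
  rw [mul_neg] at k2
  nlinarith [k1, k2]

/-- Under the binomial distribution, the deviation from the mean measured in units of `√n` has an
exponential moment bounded independently of `n` and `t`. -/
lemma sum_binomialWeight_mul_exp_abs_le {n : ℕ} (hn : 1 ≤ n) {t : ℝ}
    (ht : t ∈ Set.Icc (0 : ℝ) 1) :
    ∑ k : Fin (n + 1), binomialWeight n k t * Real.exp (|((k : ℕ) : ℝ) - n * t| / √n) ≤
      2 * Real.exp 1 := by
  have hn' : (1 : ℝ) ≤ n := by exact_mod_cast hn
  have hsq : (1 : ℝ) ≤ √n := Real.one_le_sqrt.mpr hn'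
  have mgf : ∀ s : ℝ, |s| ≤ 1 → s ^ 2 = 1 / n →
      ∑ k : Fin (n + 1), binomialWeight n k t * Real.exp (s * ((k : ℕ) - n * t)) ≤
        Real.exp 1 := by
    intro s hs hs2
    rw [sum_binomialWeight_mul_exp]
    have h0 : 0 ≤ t * Real.exp (s * (1 - t)) + (1 - t) * Real.exp (-(s * t)) :=
      add_nonneg (mul_nonneg ht.1 (Real.exp_nonneg _))
        (mul_nonneg (by linarith [ht.2]) (Real.exp_nonneg _))
    refine (pow_le_pow_left₀ h0 (bernoulli_mgf_le ht hs) n).trans ?_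
    rw [← Real.exp_nat_mul, hs2, mul_one_div_cancel (by positivity)]
  have hs : |1 / √(n : ℝ)| ≤ 1 := by
    rw [abs_of_nonneg (by positivity)]
    exact (div_le_one (by positivity)).mpr hsq
  have hs2 : (1 / √(n : ℝ)) ^ 2 = 1 / n := by
    rw [div_pow, one_pow, Real.sq_sqrt (by positivity)]
  have m1 := mgf (1 / √n) hs hs2
  have m2 := mgf (-(1 / √n)) (by rwa [abs_neg]) (by rwa [neg_sq])
  calc _ ≤ ∑ k : Fin (n + 1), (binomialWeight n k t * Real.exp (1 / √n * ((k : ℕ) - n * t)) +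
        binomialWeight n k t * Real.exp (-(1 / √n) * ((k : ℕ) - n * t))) := by
        refine Finset.sum_le_sum fun k _ => ?_
        rw [← mul_add]
        refine mul_le_mul_of_nonneg_left ?_ (binomialWeight_nonneg n k ht)
        rw [neg_mul, one_div_mul_eq_div]
        have : |((k : ℕ) : ℝ) - n * t| / √n = |(((k : ℕ) : ℝ) - n * t) / √n| := by
          rw [abs_div, abs_of_nonneg (Real.sqrt_nonneg _)]
        rw [this]
        exact Real.exp_abs_le _
    _ ≤ 2 * Real.exp 1 := by
        rw [Finset.sum_add_distrib]
        linarith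

variable {d : ℕ}

lemma bernsteinWeight_nonneg (n : ℕ) (h : Fin d → Fin (n + 1)) {x : EuclideanSpace ℝ (Fin d)}
    (hx : x ∈ cube d) : 0 ≤ bernsteinWeight n h x :=
  Finset.prod_nonneg fun i _ => binomialWeight_nonneg n (h i) (hx i)

lemma sum_bernsteinWeight (n : ℕ) (x : EuclideanSpace ℝ (Fin d)) :
    ∑ h : Fin d → Fin (n + 1), bernsteinWeight n h x = 1 := by
  have := Fintype.prod_sum fun (i : Fin d) (k : Fin (n + 1)) => binomialWeight n k (x i)
  simp only [sum_binomialWeight, Finset.prod_const_one] at this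
  exact this.symm

/-- The marginals of the product binomial distribution are binomial. -/
lemma sum_bernsteinWeight_mul (n : ℕ) (x : EuclideanSpace ℝ (Fin d)) (i : Fin d)
    (g : Fin (n + 1) → ℝ) :
    ∑ h : Fin d → Fin (n + 1), bernsteinWeight n h x * g (h i) =
      ∑ k : Fin (n + 1), binomialWeight n k (x i) * g k := by
  have := Fintype.prod_sum fun (j : Fin d) (k : Fin (n + 1)) =>
    binomialWeight n k (x j) * if j = i then g k else 1
  rw [Finset.prod_eq_single i (fun j _ hj => by simp [hj, sum_binomialWeight]) (by simp)] at this
  simp only [if_true, Finset.prod_mul_distrib, Finset.prod_ite_eq', Finset.mem_univ] at this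
  exact this.symm

/-! ### Grid cells and oscillations -/

/-- The index of the grid interval containing `t ∈ [0, 1]`, when `[0, 1]` is cut into `N + 1`
intervals of equal length. The intervals are closed on the left and open on the right, except that
the last one contains its right end point `1`. -/
noncomputable def intervalIndex (N : ℕ) (t : ℝ) : Fin (N + 1) :=
  ⟨min ⌊((N : ℝ) + 1) * t⌋₊ N, by omega⟩

lemma intervalIndex_le {N : ℕ} {t : ℝ} (ht : 0 ≤ t) :
    ((intervalIndex N t : ℕ) : ℝ) ≤ (N + 1) * t := by
  have h1 : ((intervalIndex N t : ℕ) : ℝ) ≤ (⌊((N : ℝ) + 1) * t⌋₊ : ℝ) :=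
    Nat.cast_le.mpr (min_le_left _ _)
  exact h1.trans (Nat.floor_le (by positivity))

lemma le_intervalIndex_add_one {N : ℕ} {t : ℝ} (ht : t ≤ 1) :
    (N + 1) * t ≤ ((intervalIndex N t : ℕ) : ℝ) + 1 := by
  unfold intervalIndex
  rcases le_total ⌊((N : ℝ) + 1) * t⌋₊ N with h | h
  · simp only [min_eq_left h]
    exact (Nat.lt_floor_add_one _).le
  · simp only [min_eq_right h]
    nlinarith

lemma measurable_intervalIndex (N : ℕ) : Measurable (intervalIndex N) := by
  have h1 : Measurable fun t : ℝ => ⌊((N : ℝ) + 1) * t⌋₊ :=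
    Nat.measurable_floor.comp (measurable_id.const_mul _)
  have h2 : Measurable fun m : ℕ => (⟨min m N, by omega⟩ : Fin (N + 1)) :=
    measurable_of_countable _
  exact h2.comp h1

lemma volume_intervalIndex_preimage (N : ℕ) (k : Fin (N + 1)) :
    volume (Set.Icc (0 : ℝ) 1 ∩ intervalIndex N ⁻¹' {k}) = ENNReal.ofReal (1 / (N + 1)) := by
  have hN : (0 : ℝ) < N + 1 := by positivity
  have hlen : ((k : ℕ) + 1 : ℝ) / (N + 1) - (k : ℕ) / (N + 1) = 1 / (N + 1) := by
    field_simp; ring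
  apply le_antisymm
  · rw [← hlen, ← Real.volume_Icc]
    refine measure_mono ?_
    rintro t ⟨⟨h0, h1⟩, rfl⟩
    exact ⟨(div_le_iff₀' hN).mpr (intervalIndex_le h0),
      (le_div_iff₀' hN).mpr (le_intervalIndex_add_one h1)⟩
  · rw [← hlen, ← Real.volume_Ico]
    refine measure_mono ?_
    rintro t ⟨h0, h1⟩
    have h0' := (div_le_iff₀' hN).mp h0
    have h1' := (lt_div_iff₀' hN).mp h1
    have hk : ((k : ℕ) : ℝ) ≤ N := by exact_mod_cast Nat.lt_succ_iff.mp k.2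
    have ht0 : 0 ≤ t := le_trans (by positivity) h0
    refine ⟨⟨ht0, ?_⟩, ?_⟩
    · by_contra! hc
      nlinarith
    · have hf : ⌊((N : ℝ) + 1) * t⌋₊ = (k : ℕ) :=
        (Nat.floor_eq_iff (by positivity)).mpr ⟨h0', h1'⟩
      simp only [Set.mem_preimage, Set.mem_singleton_iff]
      ext
      simp only [intervalIndex, hf]
      exact min_eq_left (Nat.lt_succ_iff.mp k.2)

/-- The multi-index of the grid cell containing a point of the cube. -/
noncomputable def cellIndex (N : ℕ) (x : EuclideanSpace ℝ (Fin d)) : Fin d → Fin (N + 1) :=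
  fun i => intervalIndex N (x i)

lemma measurable_cellIndex (N : ℕ) :
    Measurable (cellIndex N : EuclideanSpace ℝ (Fin d) → Fin d → Fin (N + 1)) := by
  refine measurable_pi_lambda _ fun i => (measurable_intervalIndex N).comp ?_
  fun_prop

lemma volume_cellIndex_preimage (N : ℕ) (k : Fin d → Fin (N + 1)) :
    volume (cube d ∩ cellIndex N ⁻¹' {k}) = ENNReal.ofReal (1 / (N + 1)) ^ d := by
  have hset : cube d ∩ cellIndex N ⁻¹' {k} = (MeasurableEquiv.toLp 2 (Fin d → ℝ)).symm ⁻¹'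
      Set.univ.pi fun i => Set.Icc (0 : ℝ) 1 ∩ intervalIndex N ⁻¹' {k i} := by
    ext x
    simp only [cube, cellIndex, Set.mem_inter_iff, Set.mem_ofPred_eq, Set.mem_preimage,
      Set.mem_singleton_iff, funext_iff, Set.mem_univ_pi, forall_and]
    rfl
  rw [hset, (EuclideanSpace.volume_preserving_symm_measurableEquiv_toLp
    (Fin d)).measure_preimage_equiv, volume_pi_pi]
  simp [volume_intervalIndex_preimage]

/-- A function constant on the grid cells is integrated over the cube by summing its values, since
all cells have the same volume. -/
lemma setLIntegral_cellIndex (N : ℕ) (F : (Fin d → Fin (N + 1)) → ℝ≥0∞) :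
    ∫⁻ x in cube d, F (cellIndex N x) =
      (∑ k, F k) * ENNReal.ofReal (1 / (N + 1)) ^ d := by
  rw [← lintegral_map (f := F) (measurable_of_countable _) (measurable_cellIndex N),
    lintegral_fintype, Finset.sum_mul]
  refine Finset.sum_congr rfl fun k _ => ?_
  rw [Measure.map_apply (measurable_cellIndex N) (measurableSet_singleton k),
    Measure.restrict_apply (measurable_cellIndex N (measurableSet_singleton k)),
    Set.inter_comm, volume_cellIndex_preimage]

/-- The part of the cube covered by the closed cell of index `k` and the cells that touch it. -/
def block (N : ℕ) (k : Fin d → Fin (N + 1)) : Set (EuclideanSpace ℝ (Fin d)) :=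
  {t ∈ cube d | ∀ i, ((k i : ℕ) : ℝ) - 1 ≤ (N + 1) * t i ∧ (N + 1) * t i ≤ (k i : ℕ) + 2}

/-- The oscillation of `f` on `block N k`. -/
noncomputable def oscillation (N : ℕ) (f : EuclideanSpace ℝ (Fin d) → ℝ)
    (k : Fin d → Fin (N + 1)) : ℝ≥0∞ :=
  Metric.ediam (f '' block N k)

lemma mem_block {N : ℕ} {k : Fin d → Fin (N + 1)} {x : EuclideanSpace ℝ (Fin d)}
    (hx : x ∈ cube d)
    (h : ∀ i, (k i : ℕ) ≤ cellIndex N x i + 1 ∧ (cellIndex N x i : ℕ) ≤ k i + 1) :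
    x ∈ block N k := by
  refine ⟨hx, fun i => ?_⟩
  have h1 := intervalIndex_le (N := N) (hx i).1
  have h2 := le_intervalIndex_add_one (N := N) (hx i).2
  have h3 : ((k i : ℕ) : ℝ) ≤ (intervalIndex N (x i) : ℕ) + 1 := by exact_mod_cast (h i).1
  have h4 : ((intervalIndex N (x i) : ℕ) : ℝ) ≤ (k i : ℕ) + 1 := by exact_mod_cast (h i).2
  constructor <;> linarith

lemma edist_le_oscillation {N : ℕ} (f : EuclideanSpace ℝ (Fin d) → ℝ)
    {k : Fin d → Fin (N + 1)} {x y : EuclideanSpace ℝ (Fin d)}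
    (hx : x ∈ block N k) (hy : y ∈ block N k) : edist (f x) (f y) ≤ oscillation N f k :=
  Metric.edist_le_ediam_of_mem (Set.mem_image_of_mem f hx) (Set.mem_image_of_mem f hy)

/-- The local modulus dominates the oscillation around the cell of `x` as soon as the blocks are
small compared with `δ`. -/
lemma oscillation_cellIndex_le_localModulus {N : ℕ} (hd : 1 ≤ d)
    (f : EuclideanSpace ℝ (Fin d) → ℝ) {x : EuclideanSpace ℝ (Fin d)} (hx : x ∈ cube d) {δ : ℝ}
    (hδ : 4 * d / (N + 1) ≤ δ) :
    oscillation N f (cellIndex N x) ≤ localModulus (cube d) f x δ := by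
  have hN : (0 : ℝ) < N + 1 := by positivity
  have hd' : (1 : ℝ) ≤ d := by exact_mod_cast hd
  have near : ∀ t ∈ block N (cellIndex N x), ‖t - x‖ ≤ δ / 2 := by
    rintro t ⟨-, ht⟩
    have hc : ∀ i, ‖(t - x) i‖ ^ 2 ≤ (2 / (N + 1 : ℝ)) ^ 2 := by
      intro i
      have h1 := intervalIndex_le (N := N) (hx i).1
      have h2 := le_intervalIndex_add_one (N := N) (hx i).2
      have h3 := ht i
      simp only [cellIndex] at h3
      refine pow_le_pow_left₀ (norm_nonneg _) ?_ 2
      rw [PiLp.sub_apply, Real.norm_eq_abs, le_div_iff₀ hN]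
      have habs : |t i - x i| * ((N : ℝ) + 1) = |(t i - x i) * (N + 1)| := by
        rw [abs_mul, abs_of_pos hN]
      rw [habs, abs_le]
      constructor <;> linarith [h3.1, h3.2]
    rw [EuclideanSpace.norm_eq]
    refine Real.sqrt_le_iff.mpr ⟨?_, ?_⟩
    · exact div_nonneg (le_trans (by positivity) hδ) (by norm_num)
    · calc ∑ i, ‖(t - x) i‖ ^ 2 ≤ ∑ _i : Fin d, (2 / (N + 1 : ℝ)) ^ 2 :=
            Finset.sum_le_sum fun i _ => hc i
        _ = d * (2 / (N + 1 : ℝ)) ^ 2 := by simp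
        _ ≤ d ^ 2 * (2 / (N + 1 : ℝ)) ^ 2 := by gcongr; nlinarith
        _ = (4 * d / (N + 1) / 2) ^ 2 := by ring
        _ ≤ (δ / 2) ^ 2 := by gcongr
  refine Metric.ediam_le ?_
  rintro _ ⟨s, hs, rfl⟩ _ ⟨t, ht, rfl⟩
  have hst : t + (s - t) = s := by abel
  have hmem : t ∈ cube d ∧ t + (s - t) ∈ cube d ∧ ‖t - x‖ ≤ δ / 2 ∧ ‖t + (s - t) - x‖ ≤ δ / 2 := by
    rw [hst]
    exact ⟨ht.1, hs.1, near t ht, near s hs⟩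
  calc edist (f s) (f t) = ENNReal.ofReal |f (t + (s - t)) - f t| := by
        rw [hst, edist_dist, Real.dist_eq]
    _ ≤ _ := by
        refine le_iSup₂_of_le t (s - t) ?_
        rw [iSup_pos hmem]

/-- Two points whose cells are at sup-distance at most `r` are joined by a chain of at most `r`
steps between touching cells, so `f` varies between them by at most the sum of the oscillations
around the cells at distance at most `r` from the first one. -/
lemma edist_le_sum_oscillation {N : ℕ} (f : EuclideanSpace ℝ (Fin d) → ℝ)
    {x : EuclideanSpace ℝ (Fin d)} (hx : x ∈ cube d) (r : ℕ) :
    ∀ y ∈ cube d,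
      (∀ i, (cellIndex N x i : ℕ) ≤ cellIndex N y i + r ∧
        (cellIndex N y i : ℕ) ≤ cellIndex N x i + r) →
      edist (f x) (f y) ≤ ∑ m : Fin d → Fin (N + 1) with
        ∀ i, (cellIndex N x i : ℕ) ≤ m i + r ∧ (m i : ℕ) ≤ cellIndex N x i + r,
        oscillation N f m := by
  induction r with
  | zero =>
    intro y hy hxy
    refine (edist_le_oscillation f (k := cellIndex N x) (mem_block hx fun i => ?_)
      (mem_block hy fun i => ?_)).trans
      (Finset.single_le_sum (f := oscillation N f) (fun _ _ => zero_le) (by simp))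
    · omega
    · have := hxy i
      omega
  | succ r ih =>
    intro y hy hxy
    have hsub : (Finset.univ.filter fun m : Fin d → Fin (N + 1) =>
        ∀ i, (cellIndex N x i : ℕ) ≤ m i + r ∧ (m i : ℕ) ≤ cellIndex N x i + r) ⊆
        Finset.univ.filter fun m : Fin d → Fin (N + 1) =>
        ∀ i, (cellIndex N x i : ℕ) ≤ m i + (r + 1) ∧ (m i : ℕ) ≤ cellIndex N x i + (r + 1) := by
      intro m hm
      simp only [Finset.mem_filter, Finset.mem_univ, true_and] at hm ⊢
      exact fun i => ⟨by linarith [(hm i).1], by linarith [(hm i).2]⟩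
    by_cases h : ∀ i, (cellIndex N x i : ℕ) ≤ cellIndex N y i + r ∧
        (cellIndex N y i : ℕ) ≤ cellIndex N x i + r
    · exact (ih y hy h).trans (Finset.sum_le_sum_of_subset hsub)
    -- `l` is the cell nearest to that of `y` in the sup-ball of radius `r`; `z` is its lower corner.
    set l : Fin d → Fin (N + 1) := fun i =>
      ⟨max ((cellIndex N x i : ℕ) - r) (min (cellIndex N y i) (cellIndex N x i + r)), by
        have h1 := (cellIndex N x i).2
        have h2 := (cellIndex N y i).2
        omega⟩ with hl
    set z : EuclideanSpace ℝ (Fin d) := WithLp.toLp 2 fun i => ((l i : ℕ) : ℝ) / (N + 1) with hz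
    have hN : (0 : ℝ) < N + 1 := by positivity
    have hzc : z ∈ cube d := fun i => by
      refine ⟨by simp only [hz]; positivity, ?_⟩
      simp only [hz]
      rw [div_le_one hN]
      exact_mod_cast (l i).2.le
    have hzl : cellIndex N z = l := by
      funext i
      have : ((N : ℝ) + 1) * z i = (l i : ℕ) := by
        simp only [hz]
        field_simp
      ext
      simp only [cellIndex, intervalIndex, this, Nat.floor_natCast]
      exact min_eq_left (Nat.lt_succ_iff.mp (l i).2)
    have hxz := ih z hzc fun i => by
      rw [hzl]
      have := hxy i
      simp only [hl]
      omega
    have hzy : edist (f z) (f y) ≤ oscillation N f (cellIndex N y) := by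
      refine edist_le_oscillation f (mem_block hzc fun i => ?_) (mem_block hy fun i => ?_)
      · rw [hzl]
        have := hxy i
        simp only [hl]
        omega
      · omega
    refine (edist_triangle _ (f z) _).trans ((add_le_add hxz hzy).trans ?_)
    rw [add_comm, ← Finset.sum_insert (f := oscillation N f) (by
      simp only [Finset.mem_filter, Finset.mem_univ, true_and]; exact h)]
    refine Finset.sum_le_sum_of_subset (Finset.insert_subset ?_ hsub)
    simp only [Finset.mem_filter, Finset.mem_univ, true_and]
    exact hxy

/-! ### Geometric decay on the grid and a discrete Young inequality -/

/-- Schur's test: a matrix of nonnegative weights with row and column sums at most `A` acts on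
`ℓ^p` with norm at most `A`. -/
lemma sum_rpow_sum_mul_le {ι : Type*} [Fintype ι] (w : ι → ι → ℝ≥0∞) (G : ι → ℝ≥0∞) {A : ℝ≥0∞}
    (hrow : ∀ k, ∑ m, w m k ≤ A) (hcol : ∀ m, ∑ k, w m k ≤ A) {p : ℝ} (hp : 1 ≤ p) :
    ∑ k, (∑ m, w m k * G m) ^ p ≤ A ^ p * ∑ m, G m ^ p := by
  have hp0 : 0 < p := by linarith
  have h1 : ∀ k, (∑ m, w m k * G m) ^ p ≤ A ^ (p - 1) * ∑ m, w m k * G m ^ p := fun k => by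
    have h := ENNReal.rpow_le_rpow (ENNReal.inner_le_weight_mul_Lp_of_nonneg Finset.univ hp
      (fun m => w m k) G) hp0.le
    refine h.trans ?_
    rw [ENNReal.mul_rpow_of_nonneg _ _ hp0.le, ← ENNReal.rpow_mul, ← ENNReal.rpow_mul,
      inv_mul_cancel₀ hp0.ne', ENNReal.rpow_one, sub_mul, inv_mul_cancel₀ hp0.ne', one_mul]
    gcongr
    exact hrow k
  calc _ ≤ ∑ k, A ^ (p - 1) * ∑ m, w m k * G m ^ p := Finset.sum_le_sum fun k _ => h1 k
    _ = A ^ (p - 1) * ∑ m, (∑ k, w m k) * G m ^ p := by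
        rw [← Finset.mul_sum, Finset.sum_comm]
        simp only [Finset.sum_mul]
    _ ≤ A ^ (p - 1) * ∑ m, A * G m ^ p := by
        gcongr with m
        exact hcol m
    _ = A ^ p * ∑ m, G m ^ p := by
        rw [← Finset.mul_sum, ← mul_assoc]
        congr 1
        nth_rw 2 [← ENNReal.rpow_one A]
        rw [← ENNReal.rpow_add_of_nonneg _ _ (by linarith) zero_le_one, sub_add_cancel]

lemma summable_pow_natAbs {q : ℝ} (hq0 : 0 ≤ q) (hq1 : q < 1) :
    Summable fun z : ℤ => q ^ z.natAbs := by
  refine Summable.of_nat_of_neg ?_ ?_ <;> simpa using summable_geometric_of_lt_one hq0 hq1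

lemma sum_pow_natAbs_sub_le {q : ℝ} (hq0 : 0 ≤ q) (hq1 : q < 1) {N : ℕ} (c : ℤ) :
    ∑ j : Fin N, q ^ (((j : ℕ) : ℤ) - c).natAbs ≤ ∑' z : ℤ, q ^ z.natAbs := by
  have hinj : Function.Injective fun j : Fin N => ((j : ℕ) : ℤ) - c := fun i j hij => by
    ext
    simpa using hij
  have h := (summable_pow_natAbs hq0 hq1).sum_le_tsum (Finset.univ.map ⟨_, hinj⟩)
    fun z _ => by positivity
  rwa [Finset.sum_map] at h

/-- The weight `q ^ ‖m - k‖₁` on pairs of multi-indices. -/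
noncomputable def decay {N : ℕ} (q : ℝ) (m k : Fin d → Fin (N + 1)) : ℝ :=
  ∏ i, q ^ (((m i : ℕ) : ℤ) - (k i : ℕ)).natAbs

lemma decay_comm {N : ℕ} (q : ℝ) (m k : Fin d → Fin (N + 1)) : decay q m k = decay q k m :=
  Finset.prod_congr rfl fun i _ => by rw [← Int.natAbs_neg, neg_sub]

lemma decay_nonneg {N : ℕ} {q : ℝ} (hq0 : 0 ≤ q) (m k : Fin d → Fin (N + 1)) :
    0 ≤ decay q m k :=
  Finset.prod_nonneg fun _ _ => pow_nonneg hq0 _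

lemma sum_decay_le {N : ℕ} {q : ℝ} (hq0 : 0 ≤ q) (hq1 : q < 1) (k : Fin d → Fin (N + 1)) :
    ∑ m, ENNReal.ofReal (decay q m k) ≤ ENNReal.ofReal ((∑' z : ℤ, q ^ z.natAbs) ^ d) := by
  rw [← ENNReal.ofReal_sum_of_nonneg fun m _ => decay_nonneg hq0 m k]
  refine ENNReal.ofReal_le_ofReal ?_
  unfold decay
  rw [← Fintype.prod_sum fun (i : Fin d) (j : Fin (N + 1)) =>
    q ^ (((j : ℕ) : ℤ) - (k i : ℕ)).natAbs]
  calc _ ≤ ∏ _i : Fin d, ∑' z : ℤ, q ^ z.natAbs :=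
        Finset.prod_le_prod (fun i _ => Finset.sum_nonneg fun j _ => pow_nonneg hq0 _)
          fun i _ => sum_pow_natAbs_sub_le hq0 hq1 _
    _ = _ := by simp

/-- The oscillations around all grid cells, averaged with geometric weights centred at the cell of
index `k`. -/
noncomputable def smoothedOscillation (N : ℕ) (q : ℝ) (f : EuclideanSpace ℝ (Fin d) → ℝ)
    (k : Fin d → Fin (N + 1)) : ℝ≥0∞ :=
  ∑ m, ENNReal.ofReal (decay q m k) * oscillation N f m

/-- The variation of `f` between two points splits into a factor depending on the cell of the first
point only and a factor depending on the distance `r` of the two cells only. -/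
lemma edist_le_smoothedOscillation_mul {N : ℕ} {q : ℝ} (hq0 : 0 < q) (hq1 : q < 1)
    (f : EuclideanSpace ℝ (Fin d) → ℝ) {x y : EuclideanSpace ℝ (Fin d)} (hx : x ∈ cube d)
    (hy : y ∈ cube d) {r : ℕ}
    (hr : ∀ i, (cellIndex N x i : ℕ) ≤ cellIndex N y i + r ∧
        (cellIndex N y i : ℕ) ≤ cellIndex N x i + r) :
    edist (f x) (f y) ≤
      smoothedOscillation N q f (cellIndex N x) * ENNReal.ofReal ((q ^ (d * r))⁻¹) := by
  refine (edist_le_sum_oscillation f hx r y hy hr).trans ?_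
  rw [smoothedOscillation, Finset.sum_mul]
  refine le_trans (Finset.sum_le_sum fun m hm => ?_)
    (Finset.sum_le_sum_of_subset (Finset.subset_univ _))
  simp only [Finset.mem_filter, Finset.mem_univ, true_and] at hm
  have h1 : q ^ (d * r) ≤ decay q m (cellIndex N x) := by
    calc q ^ (d * r) = ∏ _i : Fin d, q ^ r := by simp [← pow_mul, mul_comm]
      _ ≤ _ := Finset.prod_le_prod (fun _ _ => by positivity) fun i _ =>
          pow_le_pow_of_le_one hq0.le hq1.le (by have := hm i; omega)
  have h2 : 1 ≤ decay q m (cellIndex N x) * (q ^ (d * r))⁻¹ := by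
    rw [← div_eq_mul_inv, one_le_div (by positivity)]
    exact h1
  rw [mul_right_comm, ← ENNReal.ofReal_mul (decay_nonneg hq0.le _ _)]
  exact le_mul_of_one_le_left' (by simpa using ENNReal.ofReal_le_ofReal h2)

/-- The sup-distance of the cells of two points is attained in some coordinate, where it is
controlled by the distance of the points. -/
lemma exists_cellIndex_dist_le {N : ℕ} (hd : 1 ≤ d) {x y : EuclideanSpace ℝ (Fin d)}
    (hx : x ∈ cube d) (hy : y ∈ cube d) :
    ∃ (i : Fin d) (r : ℕ), (r : ℝ) ≤ (N + 1) * |y i - x i| + 1 ∧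
      ∀ j, (cellIndex N x j : ℕ) ≤ cellIndex N y j + r ∧
        (cellIndex N y j : ℕ) ≤ cellIndex N x j + r := by
  have hne : (Finset.univ : Finset (Fin d)).Nonempty := ⟨⟨0, hd⟩, Finset.mem_univ _⟩
  obtain ⟨i, -, hi⟩ := Finset.exists_max_image Finset.univ
    (fun j => (((cellIndex N y j : ℕ) : ℤ) - (cellIndex N x j : ℕ)).natAbs) hne
  refine ⟨i, (((cellIndex N y i : ℕ) : ℤ) - (cellIndex N x i : ℕ)).natAbs, ?_, fun j => ?_⟩
  · rw [Nat.cast_natAbs, Int.cast_abs]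
    push_cast
    have hx1 := intervalIndex_le (N := N) (hx i).1
    have hx2 := le_intervalIndex_add_one (N := N) (hx i).2
    have hy1 := intervalIndex_le (N := N) (hy i).1
    have hy2 := le_intervalIndex_add_one (N := N) (hy i).2
    have hN : (0 : ℝ) ≤ N + 1 := by positivity
    have h1 := mul_le_mul_of_nonneg_left (le_abs_self (y i - x i)) hN
    have h2 := mul_le_mul_of_nonneg_left (neg_abs_le (y i - x i)) hN
    simp only [cellIndex]
    rw [abs_le]
    constructor <;> linarith
  · have := hi j (Finset.mem_univ j)
    omega

/-! ### The pointwise estimate -/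

lemma measurableSet_cube : MeasurableSet (cube d) := by
  have : cube d = ⋂ i, (fun x : EuclideanSpace ℝ (Fin d) => x i) ⁻¹' Set.Icc (0 : ℝ) 1 := by
    ext x
    simp [cube]
  rw [this]
  exact MeasurableSet.iInter fun i =>
    (by fun_prop : Measurable fun x : EuclideanSpace ℝ (Fin d) => x i) measurableSet_Icc

lemma isProbabilityMeasure_restrict_cube :
    IsProbabilityMeasure (volume.restrict (cube d)) := by
  refine ⟨?_⟩
  have h := setLIntegral_cellIndex (d := d) 0 fun _ => 1
  simpa using h

lemma node_mem_cube {n : ℕ} (hn : 1 ≤ n) {a : ℝ} (ha : 0 ≤ a) (h : Fin d → Fin (n + 1))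
    {u : EuclideanSpace ℝ (Fin d)} (hu : u ∈ cube d) : node n a h u ∈ cube d := by
  intro i
  have hn' : (1 : ℝ) ≤ n := by exact_mod_cast hn
  have hh : ((h i : ℕ) : ℝ) ≤ n := by exact_mod_cast Nat.lt_succ_iff.mp (h i).2
  have h0 := (hu i).1
  have h1 := mul_le_mul_of_nonneg_left (hu i).2 ha
  refine ⟨?_, ?_⟩
  · simp only [node]
    positivity
  · simp only [node]
    rw [div_le_one (by positivity)]
    linarith

lemma abs_node_sub_le {n : ℕ} (hn : 1 ≤ n) {a : ℝ} (ha : 0 ≤ a) (h : Fin d → Fin (n + 1))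
    {u x : EuclideanSpace ℝ (Fin d)} (hu : u ∈ cube d) (hx : x ∈ cube d) (i : Fin d) :
    |node n a h u i - x i| ≤ (|((h i : ℕ) : ℝ) - n * x i| + a) / n := by
  have hn' : (1 : ℝ) ≤ n := by exact_mod_cast hn
  have hpos : (0 : ℝ) < n + a := by positivity
  have he : node n a h u i - x i =
      (((h i : ℕ) : ℝ) - n * x i + a * (u i - x i)) / (n + a) := by
    simp only [node]
    field_simp
    ring
  have hux : |u i - x i| ≤ 1 := abs_le.mpr
    ⟨by linarith [(hu i).1, (hx i).2], by linarith [(hu i).2, (hx i).1]⟩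
  rw [he, abs_div, abs_of_pos hpos]
  refine div_le_div₀ (by positivity) ?_ (by positivity) (by linarith)
  refine (abs_add_le _ _).trans (add_le_add le_rfl ?_)
  rw [abs_mul, abs_of_nonneg ha]
  exact mul_le_of_le_one_right ha hux

/-- The bound does not depend on `u`: the integral over `u` in the operator only averages over a
cube of side `a / (n + a)`, at most of order `1 / √n`. -/
lemma edist_node_le {n N : ℕ} (hd : 1 ≤ d) (hn : 1 ≤ n) {a : ℝ} (ha : 0 ≤ a) {η : ℝ}
    (hη0 : 0 < η) (hη1 : η ≤ 1) (hηN : η * (N + 1) ≤ √n) (f : EuclideanSpace ℝ (Fin d) → ℝ)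
    {x u : EuclideanSpace ℝ (Fin d)} (hx : x ∈ cube d) (hu : u ∈ cube d)
    (h : Fin d → Fin (n + 1)) :
    edist (f x) (f (node n a h u)) ≤
      smoothedOscillation N (Real.exp (-(η / d))) f (cellIndex N x) *
        ENNReal.ofReal (∑ i, Real.exp (1 + a) *
          Real.exp (|((h i : ℕ) : ℝ) - n * x i| / √n)) := by
  have hd' : (1 : ℝ) ≤ d := by exact_mod_cast hd
  have hn' : (1 : ℝ) ≤ n := by exact_mod_cast hn
  have hsq : (1 : ℝ) ≤ √n := Real.one_le_sqrt.mpr hn'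
  have hy := node_mem_cube hn ha h hu
  obtain ⟨i, r, hri, hr⟩ := exists_cellIndex_dist_le (N := N) hd hx hy
  have hq1 : Real.exp (-(η / d)) < 1 := Real.exp_lt_one_iff.mpr (by
    have : 0 < η / d := by positivity
    linarith)
  refine (edist_le_smoothedOscillation_mul (Real.exp_pos _) hq1 f hx hy hr).trans ?_
  refine mul_le_mul_right (ENNReal.ofReal_le_ofReal ?_) _
  have hexp : (Real.exp (-(η / d)) ^ (d * r))⁻¹ = Real.exp (η * r) := by
    rw [← Real.exp_nat_mul, ← Real.exp_neg]
    congr 1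
    push_cast
    field_simp
  rw [hexp]
  refine le_trans ?_ (Finset.single_le_sum (f := fun i => Real.exp (1 + a) *
    Real.exp (|((h i : ℕ) : ℝ) - n * x i| / √n)) (fun _ _ => by positivity) (Finset.mem_univ i))
  rw [← Real.exp_add]
  refine Real.exp_le_exp.mpr ?_
  set D := |((h i : ℕ) : ℝ) - n * x i|
  calc η * r ≤ η * ((N + 1) * |node n a h u i - x i| + 1) := by gcongr
    _ = η * (N + 1) * |node n a h u i - x i| + η := by ring
    _ ≤ √n * ((D + a) / n) + 1 := by
        gcongr
        exact abs_node_sub_le hn ha h hu hx i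
    _ = (D + a) / √n + 1 := by
        rw [mul_div_left_comm, Real.sqrt_div_self', mul_one_div]
    _ ≤ 1 + a + D / √n := by
        rw [add_div]
        linarith [div_le_self ha hsq]

/-- The error of the operator at `x` is bounded by the smoothed oscillation around the cell
of `x`. -/
lemma enorm_kantorovich_sub_le {n N : ℕ} (hd : 1 ≤ d) (hn : 1 ≤ n) {a : ℝ} (ha : 0 ≤ a) {η : ℝ}
    (hη0 : 0 < η) (hη1 : η ≤ 1) (hηN : η * (N + 1) ≤ √n) {f : EuclideanSpace ℝ (Fin d) → ℝ}
    (hf : Measurable fun x : cube d => f x) (hfb : ∃ B : ℝ, ∀ x ∈ cube d, |f x| ≤ B)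
    {x : EuclideanSpace ℝ (Fin d)} (hx : x ∈ cube d) :
    ‖kantorovich n a f x - f x‖ₑ ≤
      smoothedOscillation N (Real.exp (-(η / d))) f (cellIndex N x) *
        ENNReal.ofReal (d * (Real.exp (1 + a) * (2 * Real.exp 1))) := by
  have := isProbabilityMeasure_restrict_cube (d := d)
  set S := smoothedOscillation N (Real.exp (-(η / d))) f (cellIndex N x)
  set E : (Fin d → Fin (n + 1)) → ℝ := fun h => ∑ i, Real.exp (1 + a) *
    Real.exp (|((h i : ℕ) : ℝ) - n * x i| / √n) with hE
  have hE0 : ∀ h, 0 ≤ E h := fun h => Finset.sum_nonneg fun i _ => by positivity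
  obtain ⟨B, hB⟩ := hfb
  have hint : ∀ h, ‖(∫ u in cube d, f (node n a h u)) - f x‖ₑ ≤ S * ENNReal.ofReal (E h) := by
    intro h
    have hmeas : Measurable fun u : cube d => f (node n a h u) := by
      have hnode : Measurable fun u : EuclideanSpace ℝ (Fin d) => node n a h u := by
        unfold node
        refine (MeasurableEquiv.toLp 2 (Fin d → ℝ)).measurable.comp ?_
        fun_prop
      exact hf.comp ((hnode.comp measurable_subtype_coe).subtype_mk
        (h := fun u => node_mem_cube hn ha h u.2))
    have hi : Integrable (fun u => f (node n a h u)) (volume.restrict (cube d)) :=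
      Integrable.of_bound
        (aemeasurable_restrict_of_measurable_subtype measurableSet_cube hmeas).aestronglyMeasurable
        B ((ae_restrict_iff' measurableSet_cube).mpr
          (.of_forall fun u hu => hB _ (node_mem_cube hn ha h hu)))
    have hsub : (∫ u in cube d, f (node n a h u)) - f x =
        ∫ u in cube d, (f (node n a h u) - f x) := by
      rw [integral_sub hi (integrable_const _)]
      simp
    rw [hsub]
    refine (enorm_integral_le_lintegral_enorm _).trans ?_
    calc _ ≤ ∫⁻ _u in cube d, S * ENNReal.ofReal (E h) :=
          setLIntegral_mono' measurableSet_cube fun u hu => by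
            rw [← edist_eq_enorm_sub, edist_comm]
            exact edist_node_le hd hn ha hη0 hη1 hηN f hx hu h
      _ = _ := by simp
  have hmoment : ∑ h, bernsteinWeight n h x * E h ≤
      d * (Real.exp (1 + a) * (2 * Real.exp 1)) := by
    calc _ = ∑ i, Real.exp (1 + a) * ∑ h : Fin d → Fin (n + 1), bernsteinWeight n h x *
          Real.exp (|((h i : ℕ) : ℝ) - n * x i| / √n) := by
          simp only [hE, Finset.mul_sum]
          rw [Finset.sum_comm]
          exact Finset.sum_congr rfl fun i _ => Finset.sum_congr rfl fun h _ => by ring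
      _ ≤ ∑ _i : Fin d, Real.exp (1 + a) * (2 * Real.exp 1) := by
          refine Finset.sum_le_sum fun i _ => mul_le_mul_of_nonneg_left ?_ (Real.exp_nonneg _)
          rw [sum_bernsteinWeight_mul n x i fun k =>
            Real.exp (|((k : ℕ) : ℝ) - n * x i| / √n)]
          exact sum_binomialWeight_mul_exp_abs_le hn (hx i)
      _ = _ := by simp
  have hdecomp : kantorovich n a f x - f x = ∑ h : Fin d → Fin (n + 1),
      bernsteinWeight n h x * ((∫ u in cube d, f (node n a h u)) - f x) := by
    simp only [mul_sub, Finset.sum_sub_distrib, ← Finset.sum_mul, sum_bernsteinWeight, one_mul]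
    rfl
  rw [hdecomp]
  calc _ ≤ ∑ h : Fin d → Fin (n + 1),
        ‖bernsteinWeight n h x * ((∫ u in cube d, f (node n a h u)) - f x)‖ₑ := enorm_sum_le _ _
    _ ≤ ∑ h : Fin d → Fin (n + 1), S * ENNReal.ofReal (bernsteinWeight n h x * E h) := by
        refine Finset.sum_le_sum fun h _ => ?_
        have hw := bernsteinWeight_nonneg n h hx
        rw [enorm_mul, Real.enorm_of_nonneg hw, ENNReal.ofReal_mul hw, mul_left_comm]
        exact mul_le_mul_right (hint h) _
    _ = S * ENNReal.ofReal (∑ h, bernsteinWeight n h x * E h) := by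
        rw [← Finset.mul_sum, ENNReal.ofReal_sum_of_nonneg
          fun h _ => mul_nonneg (bernsteinWeight_nonneg n h hx) (hE0 h)]
    _ ≤ _ := mul_le_mul_right (ENNReal.ofReal_le_ofReal hmoment) _

/-! ### The estimate in `L^p` -/

/-- The step `δ` of the modulus is at least of order `1 / √n`. -/
lemma le_modulus_step {n : ℕ} (hd : 1 ≤ d) (hn : 1 ≤ n) {a : ℝ} (ha : 0 ≤ a) :
    1 / (2 * (1 + a) * √n) ≤
      ((3 * (n : ℝ) + a ^ 2) / (12 * ((n : ℝ) + a) ^ 2)) ^ (1 / (2 * (d : ℝ))) := by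
  have hd' : (1 : ℝ) ≤ d := by exact_mod_cast hd
  have hn' : (1 : ℝ) ≤ n := by exact_mod_cast hn
  set b := (3 * (n : ℝ) + a ^ 2) / (12 * ((n : ℝ) + a) ^ 2) with hb
  have hb0 : 0 < b := by positivity
  have hb1 : b ≤ 1 := by
    rw [hb, div_le_one (by positivity)]
    nlinarith
  have hlow : (1 / (2 * (1 + a) * √n)) ^ 2 ≤ b := by
    rw [div_pow, mul_pow, Real.sq_sqrt (by positivity), hb,
      div_le_div_iff₀ (by positivity) (by positivity)]
    have h1 : (n : ℝ) + a ≤ (1 + a) * n := by nlinarith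
    have h2 : ((n : ℝ) + a) ^ 2 ≤ ((1 + a) * n) ^ 2 := pow_le_pow_left₀ (by positivity) h1 2
    have h3 : 0 ≤ a ^ 2 * ((2 * (1 + a)) ^ 2 * n) := by positivity
    nlinarith
  calc 1 / (2 * (1 + a) * √n) ≤ √b := Real.le_sqrt_of_sq_le hlow
    _ = b ^ (1 / 2 : ℝ) := Real.sqrt_eq_rpow b
    _ ≤ b ^ (1 / (2 * (d : ℝ))) := by
        refine Real.rpow_le_rpow_of_exponent_ge hb0 hb1 ?_
        exact one_div_le_one_div_of_le (by norm_num) (by linarith)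

end HypercubeKantorovich

open HypercubeKantorovich in
theorem proposition4p2 (d : ℕ) (hd : 1 ≤ d) (a : ℝ) (ha : 0 ≤ a)
    (p : ℝ≥0∞) (hp : 1 ≤ p) (hp' : p ≠ ∞) :
    ∃ C : ℝ, 0 < C ∧
      ∀ (n : ℕ), 1 ≤ n →
      ∀ f : EuclideanSpace ℝ (Fin d) → ℝ,
        Measurable (fun x : HypercubeKantorovich.cube d => f x) →
        (∃ B : ℝ, ∀ x ∈ HypercubeKantorovich.cube d, |f x| ≤ B) →
        eLpNorm (fun x => HypercubeKantorovich.kantorovich n a f x - f x) p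
            (volume.restrict (HypercubeKantorovich.cube d))
          ≤ ENNReal.ofReal C *
            HypercubeKantorovich.averagedModulus (HypercubeKantorovich.cube d) f
              (((3 * (n : ℝ) + a ^ 2) / (12 * ((n : ℝ) + a) ^ 2)) ^ (1 / (2 * (d : ℝ)))) p := by
  have hd' : (1 : ℝ) ≤ d := by exact_mod_cast hd
  -- With `N + 1 ≥ c √n` cells per side, the blocks fit into balls of radius `δ / 2`; with
  -- `η = 1 / (c + 2)`, the weights `exp (η r)` have a bounded mean.
  set c : ℝ := 8 * d * (1 + a) with hc
  have hc0 : 0 < c := by positivity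
  set η : ℝ := 1 / (c + 2) with hη
  have hη0 : 0 < η := by positivity
  have hη1 : η ≤ 1 := by
    rw [hη, div_le_one (by positivity)]
    linarith
  set q : ℝ := Real.exp (-(η / d)) with hq
  have hq0 : 0 < q := Real.exp_pos _
  have hq1 : q < 1 := Real.exp_lt_one_iff.mpr (by
    have : 0 < η / d := by positivity
    linarith)
  set A : ℝ := (∑' z : ℤ, q ^ z.natAbs) ^ d with hA
  have hA0 : 0 < A := pow_pos ((summable_pow_natAbs hq0.le hq1).tsum_pos
    (fun z => by positivity) 0 (by simp)) d
  set K : ℝ := d * (Real.exp (1 + a) * (2 * Real.exp 1)) with hK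
  have hK0 : 0 < K := by positivity
  refine ⟨K * A, by positivity, fun n hn f hf hfb => ?_⟩
  have hn' : (1 : ℝ) ≤ n := by exact_mod_cast hn
  have hsq : (1 : ℝ) ≤ √n := Real.one_le_sqrt.mpr hn'
  set δ := ((3 * (n : ℝ) + a ^ 2) / (12 * ((n : ℝ) + a) ^ 2)) ^ (1 / (2 * (d : ℝ)))
  set N : ℕ := ⌈c * √n⌉₊ with hNdef
  have hN1 : c * √n ≤ N := Nat.le_ceil _
  have hN2 : (N : ℝ) < c * √n + 1 := Nat.ceil_lt_add_one (by positivity)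
  have hηN : η * (N + 1) ≤ √n := by
    rw [hη, one_div_mul_eq_div, div_le_iff₀ (by positivity)]
    nlinarith
  have hNδ : 4 * d / ((N : ℝ) + 1) ≤ δ := by
    refine le_trans ?_ (le_modulus_step hd hn ha)
    rw [div_le_div_iff₀ (by positivity) (by positivity)]
    rw [hc] at hN1
    linarith
  have hp1 : 1 ≤ p.toReal := by
    simpa using ENNReal.toReal_mono hp' hp
  have hp0 : 0 < p.toReal := by linarith
  have hpne : p ≠ 0 := (zero_lt_one.trans_le hp).ne'
  rw [averagedModulus, eLpNorm_eq_lintegral_rpow_enorm_toReal hpne hp',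
    eLpNorm_eq_lintegral_rpow_enorm_toReal hpne hp']
  simp only [enorm_eq_self]
  rw [one_div, ENNReal.rpow_inv_le_iff hp0, ENNReal.mul_rpow_of_nonneg _ _ hp0.le,
    ← ENNReal.rpow_mul, inv_mul_cancel₀ hp0.ne', ENNReal.rpow_one]
  set v : ℝ≥0∞ := ENNReal.ofReal (1 / (N + 1)) ^ d
  calc _ ≤ ∫⁻ x in cube d,
        (smoothedOscillation N q f (cellIndex N x) * ENNReal.ofReal K) ^ p.toReal :=
        setLIntegral_mono' measurableSet_cube fun x hx => by
          gcongr
          exact enorm_kantorovich_sub_le hd hn ha hη0 hη1 hηN hf hfb hx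
    _ = ENNReal.ofReal K ^ p.toReal * (∑ k, smoothedOscillation N q f k ^ p.toReal) * v := by
        rw [setLIntegral_cellIndex N
          fun k => (smoothedOscillation N q f k * ENNReal.ofReal K) ^ p.toReal, Finset.mul_sum]
        simp only [ENNReal.mul_rpow_of_nonneg _ _ hp0.le, mul_comm]
        rfl
    _ ≤ ENNReal.ofReal K ^ p.toReal *
        (ENNReal.ofReal A ^ p.toReal * ∑ m, oscillation N f m ^ p.toReal) * v := by
        gcongr
        refine sum_rpow_sum_mul_le (fun m k => ENNReal.ofReal (decay q m k)) (oscillation N f)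
          (sum_decay_le hq0.le hq1) (fun m => ?_) hp1
        simp only [decay_comm q m]
        exact sum_decay_le hq0.le hq1 m
    _ = ENNReal.ofReal (K * A) ^ p.toReal *
        ∫⁻ x in cube d, oscillation N f (cellIndex N x) ^ p.toReal := by
        rw [setLIntegral_cellIndex N fun k => oscillation N f k ^ p.toReal,
          ENNReal.ofReal_mul hK0.le, ENNReal.mul_rpow_of_nonneg _ _ hp0.le]
        simp only [mul_assoc]
        rfl
    _ ≤ _ := by
        refine mul_le_mul_right (setLIntegral_mono' measurableSet_cube fun x hx => ?_) _
        gcongr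
        exact oscillation_cellIndex_le_localModulus hd f hx hNδ
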